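/- Let $n\ge 1$ and let $A=(a_{ij})$ be an $n\times n$ real matrix with nonnegative entries and zero diagonal that is irreducible (for all $i,j$ there is $k\ge 1$ with $(A^k)_{ij}>0$). Let $r_i=\sum_{j=1}^n a_{ij}$ be its row sums, $s_i=\sum_{j=1}^n a_{ij}r_j$, $B=A+\operatorname{diag}(r_1,\dots,r_n)$, let $\rho(B)$ be the spectral radius of $B$ (the largest modulus of its complex eigenvalues), and $$F(i,j)=\frac{r_i+r_j+\sqrt{(r_i-r_j)^2+\frac{4s_is_j}{r_ir_j}}}{2}\qquad(1\le i,j\le n).$$ Then the minimum and maximum below exist and $$\min\{F(i,j): a_{ij}\ne 0\}\;\le\;\rho(B)\;\le\;\max\{F(i,j): a_{ij}\ne 0\}.$$ Moreover, the left inequality is an equality if and only if (i) or (ii) below holds, and the right inequality is an equality if and only if (i) or (ii) holds: (i) $r_i+\frac{s_i}{r_i}=r_j+\frac{s_j}{r_j}$ for all $i,j\in\{1,\dots,n\}$; (ii) there is a real number $l>0$ such that, after some simultaneous relabelling of the rows and columns, there is an integer $k$ with $1\le k<n$ such that all off-diagonal entries $b_{ij}$ of $B$ with $i,j\le k$ or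 with $i,j\ge k+1$ vanish, and $$r_1+\frac{l s_1}{r_1}=\dots=r_k+\frac{l s_k}{r_k}=r_{k+1}+\frac{s_{k+1}}{l\,r_{k+1}}=\dots=r_n+\frac{s_n}{l\,r_n}.$$ In the equality characterization for the left inequality, "$l>0$" in (ii) can be replaced by "$l>1$", and in that for the right inequality it can be replaced by "$0<l<1$" (the alternative (i) being kept in both cases). -/

import Mathlib

noncomputable section

namespace SpectralBounds

variable {n : ℕ}

/-- The `i`-th row sum `r_i = ∑ j, a_ij`. -/
def rowSum (A : Matrix (Fin n) (Fin n) ℝ) (i : Fin n) : ℝ := ∑ j, A i j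

/-- `s_i = ∑ j, a_ij * r_j`. -/
def secondSum (A : Matrix (Fin n) (Fin n) ℝ) (i : Fin n) : ℝ := ∑ j, A i j * rowSum A j

/-- The matrix `B = A + diag (r_1, ..., r_n)`. -/
def addRowSums (A : Matrix (Fin n) (Fin n) ℝ) : Matrix (Fin n) (Fin n) ℝ :=
  A + Matrix.diagonal (rowSum A)

/-- The spectral radius of a real square matrix: the largest modulus of its complex eigenvalues. -/
def rho (M : Matrix (Fin n) (Fin n) ℝ) : ℝ :=
  (spectralRadius ℂ (M.map (fun x : ℝ => (x : ℂ)))).toReal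

/-- `F (i, j) = (r_i + r_j + √((r_i - r_j)² + 4 s_i s_j / (r_i r_j))) / 2`. -/
def F (A : Matrix (Fin n) (Fin n) ℝ) (i j : Fin n) : ℝ :=
  (rowSum A i + rowSum A j
    + Real.sqrt ((rowSum A i - rowSum A j) ^ 2
        + 4 * secondSum A i * secondSum A j / (rowSum A i * rowSum A j))) / 2

/-- The values `F (i, j)` over the pairs with `a_ij ≠ 0`. -/
def FValues (A : Matrix (Fin n) (Fin n) ℝ) : Set ℝ :=
  {x | ∃ i j : Fin n, A i j ≠ 0 ∧ x = F A i j}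

/-- `r_i + s_i / r_i` has the same value for all `i`. -/
def CondI (A : Matrix (Fin n) (Fin n) ℝ) : Prop :=
  ∀ i j : Fin n,
    rowSum A i + secondSum A i / rowSum A i = rowSum A j + secondSum A j / rowSum A j

/-- The block form with a diagonal `k × k` block and a diagonal `(n - k) × (n - k)` block on the
diagonal: off-diagonal entries vanish when both indices lie in `{1, ..., k}` or both lie in
`{k + 1, ..., n}` (the index `i : Fin n` stands for the row number `i + 1`). -/
def IsPartitioned (M : Matrix (Fin n) (Fin n) ℝ) (k : ℕ) : Prop :=
  ∀ i j : Fin n, i ≠ j →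
    (((i : ℕ) < k ∧ (j : ℕ) < k) ∨ (k ≤ (i : ℕ) ∧ k ≤ (j : ℕ))) → M i j = 0

/-- The second equality condition with parameter `l`: after a relabelling `σ` of the indices
(the same for rows and columns), `B` has the block form for some `1 ≤ k < n`, and the numbers
`r_i + l s_i / r_i` for `i ≤ k` and `r_i + s_i / (l r_i)` for `i > k` are all equal. -/
def CondII (A : Matrix (Fin n) (Fin n) ℝ) (l : ℝ) : Prop :=
  ∃ k : ℕ, 1 ≤ k ∧ k < n ∧ ∃ σ : Equiv.Perm (Fin n),
    IsPartitioned ((addRowSums A).submatrix σ σ) k ∧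
    ∃ m : ℝ,
      (∀ i : Fin n, (i : ℕ) < k →
        rowSum A (σ i) + l * secondSum A (σ i) / rowSum A (σ i) = m) ∧
      (∀ i : Fin n, k ≤ (i : ℕ) →
        rowSum A (σ i) + secondSum A (σ i) / (l * rowSum A (σ i)) = m)

end SpectralBounds

end

namespace SpectralBounds

open Matrix

/-! ### Perron eigenvectors via the Collatz–Wielandt maximum. -/

section PerronFrobenius

variable {ι : Type*} [Fintype ι]

/-! Let `y > 0` be a Perron vector of `B`, with eigenvalue `μ = ρ(B)`, and put `x i = y i / r i`.
Then `∑ j, a_ij r_j x_j = U_i x_i` with `U_i = (μ - r_i) r_i`, where the weights `a_ij r_j` have row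
sums `s_i`. Since `F (i, j)` is the larger root of `(t - r_i)(t - r_j) = s_i s_j / (r_i r_j)`,
comparing it with `μ` amounts to comparing `s_i s_j` with `U_i U_j`.

If `F ≤ μ` on all edges, evaluate the equation at a maximizer of `x` and at its largest neighbour:
the two estimates multiply to the reverse inequality, so all are equalities. Along paths this makes
`x` take two values `a`, `b` alternating on edges (`exists_two_values`). The case `a = b` is (i);
otherwise (ii) holds with `l = b / a`. A sign `ε` covers `F ≥ μ` as well.

Conversely, (i) and (ii) provide explicit positive eigenvectors, so `F = ρ(B)` on every edge. The
bounds follow: were one to fail, (i) or (ii) would hold and force equality. -/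

lemma exists_pos_mul_le [Nonempty ι] {w y : ι → ℝ} (hw : ∀ i, 0 < w i) (hy : ∀ i, 0 < y i) :
    ∃ δ : ℝ, 0 < δ ∧ ∀ i, δ * y i ≤ w i := by
  obtain ⟨i₀, h₀⟩ := Finite.exists_min fun i => w i / y i
  exact ⟨w i₀ / y i₀, div_pos (hw _) (hy _), fun i => (le_div_iff₀ (hy i)).1 (h₀ i)⟩

lemma mulVec_pos_of_pos {P : Matrix ι ι ℝ} (hP : ∀ i j, 0 < P i j) {z : ι → ℝ}
    (hz : ∀ i, 0 ≤ z i) (hz0 : z ≠ 0) (i : ι) : 0 < (P *ᵥ z) i := by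
  obtain ⟨j, hj⟩ := Function.ne_iff.1 hz0
  exact Finset.sum_pos' (fun k _ => mul_nonneg (hP i k).le (hz k))
    ⟨j, Finset.mem_univ j, mul_pos (hP i j) (lt_of_le_of_ne (hz j) (Ne.symm hj))⟩

/-- Perron's theorem for a nonnegative matrix that commutes with a positive one. -/
theorem exists_pos_eigenvector [Nonempty ι] {M P : Matrix ι ι ℝ} (hM : ∀ i j, 0 ≤ M i j)
    (hP : ∀ i j, 0 < P i j) (hMP : Commute M P) :
    ∃ (μ : ℝ) (x : ι → ℝ), (∀ i, 0 < x i) ∧ M *ᵥ x = μ • x := by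
  classical
  set T : ℝ := ∑ i, ∑ j, M i j with hT
  have hT0 : 0 ≤ T := Finset.sum_nonneg fun i _ => Finset.sum_nonneg fun j _ => hM i j
  -- Pairs `(t, x)` with `t x ≤ M x`. The bound `t ≤ T` costs nothing, as summing the inequalities
  -- shows, and makes the set compact.
  let K : Set (ℝ × (ι → ℝ)) :=
    (Set.Icc 0 T ×ˢ stdSimplex ℝ ι) ∩ {p | ∀ i, p.1 * p.2 i ≤ (M *ᵥ p.2) i}
  have hKc : IsCompact K := by
    refine (isCompact_Icc.prod (isCompact_stdSimplex ℝ ι)).inter_right ?_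
    simp only [Set.ofPred_forall]
    refine isClosed_iInter fun i => isClosed_le (by fun_prop) ?_
    simp only [mulVec, dotProduct]
    fun_prop
  have hmem : ∀ (t : ℝ) (y : ι → ℝ), 0 ≤ t → (∀ i, 0 ≤ y i) → y ≠ 0 →
      (∀ i, t * y i ≤ (M *ᵥ y) i) → ∃ y', (t, y') ∈ K := by
    intro t y ht hy hy0 hle
    have hs : 0 < ∑ i, y i := by
      obtain ⟨j, hj⟩ := Function.ne_iff.1 hy0
      exact Finset.sum_pos' (fun k _ => hy k)
        ⟨j, Finset.mem_univ j, lt_of_le_of_ne (hy j) (Ne.symm hj)⟩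
    have hle' : ∀ i, y i ≤ ∑ j, y j := fun i =>
      Finset.single_le_sum (fun k _ => hy k) (Finset.mem_univ i)
    refine ⟨(∑ i, y i)⁻¹ • y, ⟨⟨⟨ht, ?_⟩, ⟨fun i => ?_, ?_⟩⟩, fun i => ?_⟩⟩
    · have h1 : t * ∑ i, y i ≤ T * ∑ i, y i := by
        rw [Finset.mul_sum]
        refine (Finset.sum_le_sum fun i _ => hle i).trans ?_
        rw [hT, Finset.sum_mul]
        refine Finset.sum_le_sum fun i _ => ?_
        rw [Finset.sum_mul]
        exact Finset.sum_le_sum fun j _ => mul_le_mul_of_nonneg_left (hle' j) (hM i j)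
      exact le_of_mul_le_mul_right h1 hs
    · exact mul_nonneg (inv_nonneg.2 hs.le) (hy i)
    · simp only [Pi.smul_apply, smul_eq_mul, ← Finset.mul_sum]
      exact inv_mul_cancel₀ hs.ne'
    · simp only [mulVec_smul, Pi.smul_apply, smul_eq_mul]
      have := mul_le_mul_of_nonneg_left (hle i) (inv_nonneg.2 hs.le)
      linarith
  have hKn : K.Nonempty := by
    obtain ⟨y, hy⟩ := hmem 0 1 le_rfl (fun _ => zero_le_one) one_ne_zero fun i => by
      rw [zero_mul]
      exact Finset.sum_nonneg fun j _ => mul_nonneg (hM i j) zero_le_one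
    exact ⟨_, hy⟩
  obtain ⟨⟨t, x⟩, ⟨⟨⟨ht0, -⟩, hx0, hx1⟩, hle⟩, hmax⟩ :=
    hKc.exists_isMaxOn hKn continuous_fst.continuousOn
  simp only [Set.mem_ofPred_eq] at hle ht0 hx0 hx1
  have hxne : x ≠ 0 := by
    rintro rfl
    simp at hx1
  have hPx : ∀ i, 0 < (P *ᵥ x) i := mulVec_pos_of_pos hP hx0 hxne
  have hcomm : M *ᵥ (P *ᵥ x) = P *ᵥ (M *ᵥ x) := by
    rw [mulVec_mulVec, mulVec_mulVec, hMP.eq]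
  have heig : M *ᵥ x = t • x := by
    by_contra hne
    have hPz : ∀ i, 0 < (P *ᵥ (M *ᵥ x - t • x)) i :=
      mulVec_pos_of_pos hP (fun i => by simpa using hle i) (sub_ne_zero.2 hne)
    obtain ⟨δ, hδ, hδle⟩ := exists_pos_mul_le hPz hPx
    obtain ⟨y', hy'⟩ := hmem (t + δ) (P *ᵥ x) (by positivity) (fun i => (hPx i).le)
      (fun h => (hPx (Classical.arbitrary ι)).ne' (congrFun h _)) fun i => by
        have := hδle i
        rw [mulVec_sub, mulVec_smul, ← hcomm] at this
        simp only [Pi.sub_apply, Pi.smul_apply, smul_eq_mul] at this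
        linarith
    have : t + δ ≤ t := hmax hy'
    linarith
  refine ⟨t, P *ᵥ x, hPx, ?_⟩
  rw [hcomm, heig, mulVec_smul]

variable [DecidableEq ι]

lemma pow_le_pow_entry {A B : Matrix ι ι ℝ} (hA : ∀ i j, 0 ≤ A i j)
    (hAB : ∀ i j, A i j ≤ B i j) (k : ℕ) (i j : ι) : (A ^ k) i j ≤ (B ^ k) i j := by
  induction k generalizing i j with
  | zero => simp
  | succ k ih =>
    rw [pow_succ, pow_succ, mul_apply, mul_apply]
    exact Finset.sum_le_sum fun l _ => mul_le_mul (ih i l) (hAB l j) (hA l j)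
      (pow_apply_nonneg (fun i j => (hA i j).trans (hAB i j)) k i l)

/-- A matrix dominating an irreducible one has a positive eigenvector. -/
theorem exists_pos_eigenvector_of_isIrreducible_le [Nonempty ι] {A B : Matrix ι ι ℝ}
    (hA : A.IsIrreducible) (hAB : ∀ i j, A i j ≤ B i j) :
    ∃ (μ : ℝ) (x : ι → ℝ), (∀ i, 0 < x i) ∧ B *ᵥ x = μ • x := by
  have hB : ∀ i j, 0 ≤ B i j := fun i j => (hA.nonneg i j).trans (hAB i j)
  choose k hk0 hk using (isIrreducible_iff_exists_pow_pos hA.nonneg).1 hA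
  refine exists_pos_eigenvector (P := ∑ p : ι × ι, B ^ k p.1 p.2) hB (fun i j => ?_)
    (Commute.sum_right _ _ _ fun p _ => Commute.self_pow B _)
  rw [Matrix.sum_apply]
  exact Finset.sum_pos' (fun p _ => pow_apply_nonneg hB _ i j)
    ⟨(i, j), Finset.mem_univ _, (hk i j).trans_le (pow_le_pow_entry hA.nonneg hAB _ i j)⟩

end PerronFrobenius

/-- For any complex eigenvector `v`, the row at which `‖v i‖ / x i` is largest bounds the modulus of
its eigenvalue by `μ`. -/
theorem rho_eq_of_pos_eigenvector {n : ℕ} [NeZero n] {M : Matrix (Fin n) (Fin n) ℝ} {μ : ℝ}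
    {x : Fin n → ℝ} (hM : ∀ i j, 0 ≤ M i j) (hx : ∀ i, 0 < x i) (hMx : M *ᵥ x = μ • x) :
    rho M = μ := by
  have hrow : ∀ i, ∑ j, M i j * x j = μ * x i := fun i => congrFun hMx i
  have hμ : 0 ≤ μ := by
    refine nonneg_of_mul_nonneg_left (b := x 0) ?_ (hx 0)
    rw [← hrow]
    exact Finset.sum_nonneg fun j _ => mul_nonneg (hM 0 j) (hx j).le
  have key : spectralRadius ℂ (M.map (fun x : ℝ => (x : ℂ))) = ENNReal.ofReal μ := by
    apply le_antisymm
    · refine iSup₂_le fun z hz => ?_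
      rw [← spectrum_toLin', ← Module.End.hasEigenvalue_iff_mem_spectrum] at hz
      obtain ⟨v, hv⟩ := hz.exists_hasEigenvector
      have hv' : ∀ i, ∑ j, (M i j : ℂ) * v j = z * v i := fun i => by
        have := congrFun hv.apply_eq_smul i
        simpa [mulVec, dotProduct] using this
      obtain ⟨i, hi⟩ := Finite.exists_max fun i => ‖v i‖ / x i
      have hle : ∀ j, ‖v j‖ ≤ ‖v i‖ / x i * x j := fun j => (div_le_iff₀ (hx j)).1 (hi j)
      have hvi : 0 < ‖v i‖ := by
        rcases (norm_nonneg (v i)).eq_or_lt with h | h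
        · refine absurd (funext fun j => ?_) hv.2
          have := hle j
          rw [← h] at this
          simpa using this
        · exact h
      have h1 : ‖z‖ * ‖v i‖ ≤ μ * ‖v i‖ := by
        calc ‖z‖ * ‖v i‖ = ‖∑ j, (M i j : ℂ) * v j‖ := by rw [hv', norm_mul]
          _ ≤ ∑ j, ‖(M i j : ℂ) * v j‖ := norm_sum_le _ _
          _ = ∑ j, M i j * ‖v j‖ := by
            refine Finset.sum_congr rfl fun j _ => ?_
            rw [norm_mul, Complex.norm_real, Real.norm_of_nonneg (hM i j)]
          _ ≤ ∑ j, M i j * (‖v i‖ / x i * x j) :=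
            Finset.sum_le_sum fun j _ => mul_le_mul_of_nonneg_left (hle j) (hM i j)
          _ = ‖v i‖ / x i * ∑ j, M i j * x j := by
            rw [Finset.mul_sum]
            exact Finset.sum_congr rfl fun j _ => by ring
          _ = μ * ‖v i‖ := by
            rw [hrow]
            field_simp [(hx i).ne']
      have h2 := le_of_mul_le_mul_right h1 hvi
      rw [← enorm_eq_nnnorm, ← ofReal_norm]
      exact ENNReal.ofReal_le_ofReal h2
    · have hmem : (μ : ℂ) ∈ spectrum ℂ (M.map (fun x : ℝ => (x : ℂ))) := by
        rw [← spectrum_toLin', ← Module.End.hasEigenvalue_iff_mem_spectrum]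
        refine Module.End.hasEigenvalue_of_hasEigenvector (x := fun i => (x i : ℂ)) ⟨?_, ?_⟩
        · rw [Module.End.mem_eigenspace_iff]
          funext i
          simp only [toLin'_apply, mulVec, dotProduct, map_apply, Pi.smul_apply, smul_eq_mul]
          exact_mod_cast hrow i
        · intro h
          have := congrFun h 0
          simp [(hx 0).ne'] at this
      refine le_trans (le_of_eq ?_) (le_iSup₂ (f := fun (k : ℂ) (_ : k ∈ spectrum ℂ _) =>
        ((‖k‖₊ : NNReal) : ENNReal)) (μ : ℂ) hmem)
      rw [← enorm_eq_nnnorm, ← ofReal_norm, Complex.norm_real, Real.norm_of_nonneg hμ]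
  rw [rho, key, ENNReal.toReal_ofReal hμ]

/-! ### Rigidity of positive solutions along edges. -/

section TwoValues

variable {ι : Type*} [Fintype ι]

lemma mul_sum_mul_le {c x : ι → ℝ} {ε β : ℝ} (hc : ∀ j, 0 ≤ c j)
    (hx : ∀ j, 0 < c j → ε * x j ≤ ε * β) : ε * ∑ j, c j * x j ≤ ε * ((∑ j, c j) * β) := by
  rw [Finset.sum_mul, Finset.mul_sum, Finset.mul_sum]
  refine Finset.sum_le_sum fun j _ => ?_
  rcases (hc j).eq_or_lt with h | h
  · simp [← h]
  · nlinarith [mul_le_mul_of_nonneg_left (hx j h) h.le]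

lemma eq_of_sum_mul_eq {c x : ι → ℝ} {ε β : ℝ} (hε : ε ≠ 0) (hc : ∀ j, 0 ≤ c j)
    (hx : ∀ j, 0 < c j → ε * x j ≤ ε * β) (h : ∑ j, c j * x j = (∑ j, c j) * β) (j : ι)
    (hj : 0 < c j) : x j = β := by
  have h0 : ∀ k ∈ Finset.univ, 0 ≤ c k * (ε * β - ε * x k) := fun k _ => by
    rcases (hc k).eq_or_lt with h | h
    · simp [← h]
    · exact mul_nonneg h.le (sub_nonneg.2 (hx k h))
  have hsum : ∑ k, c k * (ε * β - ε * x k) = 0 := by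
    have : ∑ k, c k * (ε * β - ε * x k) = ε * ((∑ k, c k) * β - ∑ k, c k * x k) := by
      rw [Finset.sum_mul, ← Finset.sum_sub_distrib, Finset.mul_sum]
      exact Finset.sum_congr rfl fun k _ => by ring
    rw [this, h, sub_self, mul_zero]
  have := (Finset.sum_eq_zero_iff_of_nonneg h0).1 hsum j (Finset.mem_univ j)
  have h1 := (mul_eq_zero.1 this).resolve_left hj.ne'
  exact (mul_left_cancel₀ hε (sub_eq_zero.1 h1)).symm

lemma eq_and_eq_of_mul_le_mul {U V p q α β : ℝ} (hU : 0 < U) (hq : 0 < q)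
    (hα : 0 < α) (hβ : 0 < β) (h1 : U * α ≤ p * β) (h2 : V * β ≤ q * α)
    (h3 : p * q ≤ U * V) : U * α = p * β ∧ V * β = q * α := by
  have hαβ := mul_pos hα hβ
  have h4 := mul_le_mul_of_nonneg_right h3 hαβ.le
  have h5 := mul_le_mul_of_nonneg_right h1 (mul_pos hq hα).le
  have h6 := mul_le_mul_of_nonneg_left h2 (mul_pos hU hα).le
  constructor
  · exact mul_right_cancel₀ (mul_pos hq hα).ne' (by linarith)
  · exact mul_left_cancel₀ (mul_pos hU hα).ne' (by linarith)

lemma eq_and_eq_of_sign_mul_le {ε U V p q α β : ℝ} (hε : ε = 1 ∨ ε = -1) (hU : 0 < U)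
    (hV : 0 < V) (hp : 0 < p) (hq : 0 < q) (hα : 0 < α) (hβ : 0 < β)
    (h1 : ε * (U * α) ≤ ε * (p * β)) (h2 : ε * (V * β) ≤ ε * (q * α))
    (h3 : ε * (p * q) ≤ ε * (U * V)) : U * α = p * β ∧ V * β = q * α := by
  rcases hε with rfl | rfl
  · exact eq_and_eq_of_mul_le_mul hU hq hα hβ (by linarith) (by linarith) (by linarith)
  · obtain ⟨h4, h5⟩ := eq_and_eq_of_mul_le_mul (U := p) (V := q) (p := U) (q := V) hp hV hβ hα
      (by linarith) (by linarith) (by linarith)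
    exact ⟨h4.symm, h5.symm⟩

variable {C : Matrix ι ι ℝ} {U x : ι → ℝ} {ε : ℝ}

/-- Bounding the weighted sums at `i` and `j` by their extreme neighbours and multiplying gives the
reverse of `H`. Both bounds are thus sharp, which forces every neighbour to be extreme. -/
lemma eq_on_neighbors (hε : ε = 1 ∨ ε = -1) (hC : ∀ i j, 0 ≤ C i j)
    (hq : ∀ i, 0 < ∑ j, C i j) (hU : ∀ i, 0 < U i) (hx : ∀ i, 0 < x i)
    (heq : ∀ i, ∑ j, C i j * x j = U i * x i)
    (H : ∀ i j, 0 < C i j → ε * ((∑ k, C i k) * ∑ k, C j k) ≤ ε * (U i * U j))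
    {i j : ι} (hij : 0 < C i j) (hi : ∀ k, 0 < C i k → ε * x k ≤ ε * x j)
    (hj : ∀ k, 0 < C j k → ε * x k ≤ ε * x i) :
    (∀ k, 0 < C i k → x k = x j) ∧ ∀ k, 0 < C j k → x k = x i := by
  have hε0 : ε ≠ 0 := by rcases hε with rfl | rfl <;> norm_num
  have h1 := mul_sum_mul_le (hC i) hi
  have h2 := mul_sum_mul_le (hC j) hj
  rw [heq] at h1 h2
  obtain ⟨h3, h4⟩ := eq_and_eq_of_sign_mul_le hε (hU i) (hU j) (hq i) (hq j) (hx i) (hx j) h1 h2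
    (H i j hij)
  exact ⟨eq_of_sum_mul_eq hε0 (hC i) hi ((heq i).trans h3),
    eq_of_sum_mul_eq hε0 (hC j) hj ((heq j).trans h4)⟩

/-- If the products of row sums along the edges are on one side of the products of the `U i`, then
the positive solution `x` takes at most two values, which alternate along the edges. -/
theorem exists_two_values [Nonempty ι] (hε : ε = 1 ∨ ε = -1) (hC : ∀ i j, 0 ≤ C i j)
    (hconn : ∀ i j, Relation.ReflTransGen (fun i j => 0 < C i j) i j)
    (hq : ∀ i, 0 < ∑ j, C i j) (hU : ∀ i, 0 < U i) (hx : ∀ i, 0 < x i)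
    (heq : ∀ i, ∑ j, C i j * x j = U i * x i)
    (H : ∀ i j, 0 < C i j → ε * ((∑ k, C i k) * ∑ k, C j k) ≤ ε * (U i * U j)) :
    ∃ a b : ℝ, 0 < a ∧ 0 < b ∧ ε * b ≤ ε * a ∧
      ∀ i, (x i = a ∧ ∀ j, 0 < C i j → x j = b) ∨ (x i = b ∧ ∀ j, 0 < C i j → x j = a) := by
  classical
  obtain ⟨m, hm⟩ := Finite.exists_max fun i => ε * x i
  obtain ⟨m', -, hm'⟩ := Finset.exists_lt_of_sum_lt (s := Finset.univ) (f := fun _ => 0)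
    (g := fun j => C m j) (by simpa using hq m)
  -- `j₀` is extreme among the neighbours of all maximizers, not only of `m`; the propagation uses
  -- this whenever it reaches another maximizer.
  obtain ⟨⟨i₀, j₀⟩, hmem, hmax⟩ := Finset.exists_max_image
    (Finset.univ.filter fun p : ι × ι => x p.1 = x m ∧ 0 < C p.1 p.2) (fun p => ε * x p.2)
    ⟨(m, m'), by simpa using hm'⟩
  simp only [Finset.mem_filter, Finset.mem_univ, true_and, Prod.forall, and_imp] at hmem hmax
  obtain ⟨hi₀, h₀⟩ := hmem
  have hmax' : ∀ i, x i = x m → ∀ k, 0 < C i k → ε * x k ≤ ε * x j₀ :=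
    fun i hi k hk => hmax i k hi hk
  refine ⟨x m, x j₀, hx _, hx _, hm _, fun i => ?_⟩
  induction hconn i₀ i with
  | refl =>
    exact Or.inl ⟨hi₀, (eq_on_neighbors hε hC hq hU hx heq H h₀ (hmax' _ hi₀)
      fun k _ => hi₀ ▸ hm k).1⟩
  | @tail i j _ hij ih =>
    rcases ih with ⟨hi, hn⟩ | ⟨hi, hn⟩
    · refine Or.inr ⟨hn j hij, fun k hk => ?_⟩
      rw [← hi]
      exact (eq_on_neighbors hε hC hq hU hx heq H hij (fun k hk => by rw [hn k hk, hn j hij])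
        fun k _ => hi ▸ hm k).2 k hk
    · refine Or.inl ⟨hn j hij, fun k hk => ?_⟩
      rw [← hi]
      exact (eq_on_neighbors hε hC hq hU hx heq H hij (fun k hk => by rw [hn k hk, hn j hij])
        fun k hk => by rw [hi]; exact hmax' j (hn j hij) k hk).2 k hk

end TwoValues

/-! ### Irreducibility and positivity of the row data. -/

lemma reflTransGen_of_isIrreducible {ι : Type*} {A : Matrix ι ι ℝ} (hA : A.IsIrreducible)
    (i j : ι) : Relation.ReflTransGen (fun i j => 0 < A i j) i j := by
  let : Quiver ι := A.toQuiver
  obtain ⟨p, -⟩ := hA.connected i j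
  induction p with
  | nil => exact .refl
  | cons _ e ih => exact ih.tail e.down

/-- A single index is impossible: irreducibility demands a closed path of positive length, which
would use a zero diagonal entry. -/
lemma exists_pos_of_isIrreducible {ι : Type*} {A : Matrix ι ι ℝ} (hA : A.IsIrreducible)
    (hdiag : ∀ i, A i i = 0) (i : ι) : ∃ j, 0 < A i j := by
  have : Nontrivial ι := by
    by_contra h
    rw [not_nontrivial_iff_subsingleton] at h
    let : Quiver ι := A.toQuiver
    obtain ⟨p, hp⟩ := hA.connected i i
    cases p with
    | nil => simp at hp
    | @cons b _ q e =>
      have he : 0 < A b i := e.down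
      rw [Subsingleton.elim b i, hdiag] at he
      exact lt_irrefl _ he
  exact hA.exists_pos i

variable {n : ℕ} {A : Matrix (Fin n) (Fin n) ℝ}

lemma rowSum_pos (hA : A.IsIrreducible) (hdiag : ∀ i, A i i = 0) (i : Fin n) :
    0 < rowSum A i := by
  obtain ⟨j, hj⟩ := exists_pos_of_isIrreducible hA hdiag i
  exact Finset.sum_pos' (fun k _ => hA.nonneg i k) ⟨j, Finset.mem_univ j, hj⟩

lemma secondSum_pos (hA : A.IsIrreducible) (hdiag : ∀ i, A i i = 0) (i : Fin n) :
    0 < secondSum A i := by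
  obtain ⟨j, hj⟩ := exists_pos_of_isIrreducible hA hdiag i
  exact Finset.sum_pos' (fun k _ => mul_nonneg (hA.nonneg i k) (rowSum_pos hA hdiag k).le)
    ⟨j, Finset.mem_univ j, mul_pos hj (rowSum_pos hA hdiag j)⟩

lemma addRowSums_mulVec (y : Fin n → ℝ) (i : Fin n) :
    (addRowSums A *ᵥ y) i = ∑ j, A i j * y j + rowSum A i * y i := by
  rw [addRowSums, add_mulVec, Pi.add_apply, mulVec_diagonal]
  rfl

lemma le_addRowSums (hA : ∀ i j, 0 ≤ A i j) (i j : Fin n) : A i j ≤ addRowSums A i j := by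
  rw [addRowSums, Matrix.add_apply, Matrix.diagonal_apply]
  split_ifs
  · exact le_add_of_nonneg_right (Finset.sum_nonneg fun k _ => hA i k)
  · simp

/-! ### Comparing `F` with a number above the row sums. -/

lemma two_mul_sub_eq (μ : ℝ) (i j : Fin n) (hi : 0 < rowSum A i) (hj : 0 < rowSum A j) :
    (2 * μ - rowSum A i - rowSum A j) ^ 2 - ((rowSum A i - rowSum A j) ^ 2
        + 4 * secondSum A i * secondSum A j / (rowSum A i * rowSum A j)) =
      4 * ((μ - rowSum A i) * rowSum A i * ((μ - rowSum A j) * rowSum A j)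
        - secondSum A i * secondSum A j) / (rowSum A i * rowSum A j) := by
  field_simp
  ring

lemma F_le_iff {μ : ℝ} {i j : Fin n} (hi : 0 < rowSum A i) (hj : 0 < rowSum A j)
    (hμi : rowSum A i < μ) (hμj : rowSum A j < μ) :
    F A i j ≤ μ ↔ secondSum A i * secondSum A j
      ≤ (μ - rowSum A i) * rowSum A i * ((μ - rowSum A j) * rowSum A j) := by
  have h := two_mul_sub_eq μ i j hi hj
  have h1 : F A i j ≤ μ ↔ √((rowSum A i - rowSum A j) ^ 2
        + 4 * secondSum A i * secondSum A j / (rowSum A i * rowSum A j))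
          ≤ 2 * μ - rowSum A i - rowSum A j := by
    rw [F]
    constructor <;> intro h <;> linarith
  rw [h1, Real.sqrt_le_left (by linarith), ← sub_nonneg, h,
    le_div_iff₀ (mul_pos hi hj), zero_mul, mul_nonneg_iff_of_pos_left four_pos, sub_nonneg]

lemma le_F_iff {μ : ℝ} {i j : Fin n} (hi : 0 < rowSum A i) (hj : 0 < rowSum A j)
    (hμi : rowSum A i < μ) (hμj : rowSum A j < μ) :
    μ ≤ F A i j ↔ (μ - rowSum A i) * rowSum A i * ((μ - rowSum A j) * rowSum A j)
      ≤ secondSum A i * secondSum A j := by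
  have h := two_mul_sub_eq μ i j hi hj
  have h1 : μ ≤ F A i j ↔ 2 * μ - rowSum A i - rowSum A j ≤ √((rowSum A i - rowSum A j) ^ 2
        + 4 * secondSum A i * secondSum A j / (rowSum A i * rowSum A j)) := by
    rw [F]
    constructor <;> intro h <;> linarith
  rw [h1, Real.le_sqrt' (by linarith), ← sub_nonpos, h,
    div_le_iff₀ (mul_pos hi hj), zero_mul]
  constructor <;> intro h <;> linarith

lemma F_eq {μ : ℝ} {i j : Fin n} (hi : 0 < rowSum A i) (hj : 0 < rowSum A j)
    (hμi : rowSum A i < μ) (hμj : rowSum A j < μ)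
    (h : (μ - rowSum A i) * rowSum A i * ((μ - rowSum A j) * rowSum A j)
      = secondSum A i * secondSum A j) : F A i j = μ :=
  le_antisymm ((F_le_iff hi hj hμi hμj).2 h.ge) ((le_F_iff hi hj hμi hμj).2 h.le)

lemma isPartitioned_addRowSums_iff (k : ℕ) (σ : Equiv.Perm (Fin n)) :
    IsPartitioned ((addRowSums A).submatrix σ σ) k ↔ ∀ i j : Fin n, i ≠ j →
      (((i : ℕ) < k ∧ (j : ℕ) < k) ∨ (k ≤ (i : ℕ) ∧ k ≤ (j : ℕ))) → A (σ i) (σ j) = 0 := by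
  refine forall₃_congr fun i j hij => ?_
  simp [addRowSums, Matrix.diagonal_apply_ne _ (σ.injective.ne hij)]

/-! ### The equality conditions and the Perron vector. -/

theorem F_eq_rho_of_condI [NeZero n] (hA : A.IsIrreducible) (hdiag : ∀ i, A i i = 0)
    (h : CondI A) (i j : Fin n) : F A i j = rho (addRowSums A) := by
  have hr := rowSum_pos hA hdiag
  have hs := secondSum_pos hA hdiag
  set m := rowSum A 0 + secondSum A 0 / rowSum A 0 with hm
  have hsm : ∀ i, secondSum A i = (m - rowSum A i) * rowSum A i := fun i => by
    rw [hm, ← h i 0]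
    field_simp [(hr i).ne']
    ring
  have hrm : ∀ i, rowSum A i < m := fun i =>
    sub_pos.1 (pos_of_mul_pos_left (hsm i ▸ hs i) (hr i).le)
  have hrho : rho (addRowSums A) = m := by
    -- Since `A r = s`, condition (i) says exactly that `r` is an eigenvector of `B`.
    refine rho_eq_of_pos_eigenvector (x := rowSum A)
      (fun i j => (hA.nonneg i j).trans (le_addRowSums hA.nonneg i j)) hr (funext fun i => ?_)
    rw [addRowSums_mulVec]
    have : ∑ j, A i j * rowSum A j = secondSum A i := rfl
    rw [this, hsm, Pi.smul_apply, smul_eq_mul]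
    ring
  rw [hrho]
  exact F_eq (hr i) (hr j) (hrm i) (hrm j) (by rw [hsm i, hsm j])

theorem F_eq_rho_of_condII [NeZero n] (hA : A.IsIrreducible) (hdiag : ∀ i, A i i = 0)
    {l : ℝ} (hl : 0 < l) (h : CondII A l) {i j : Fin n} (hij : A i j ≠ 0) :
    F A i j = rho (addRowSums A) := by
  have hr := rowSum_pos hA hdiag
  have hs := secondSum_pos hA hdiag
  obtain ⟨k, -, -, σ, hpart, m, h1, h2⟩ := h
  rw [isPartitioned_addRowSums_iff] at hpart
  have hne : ∀ i j, A i j ≠ 0 → (((σ.symm i : ℕ) < k ∧ ¬ (σ.symm j : ℕ) < k) ∨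
      (¬ (σ.symm i : ℕ) < k ∧ (σ.symm j : ℕ) < k)) := fun i j hij => by
    have hne : σ.symm i ≠ σ.symm j := fun h => hij (by rw [σ.symm.injective h, hdiag])
    have := mt (hpart _ _ hne)
    simp only [Equiv.apply_symm_apply] at this
    have := this hij
    omega
  have hU : ∀ i, (σ.symm i : ℕ) < k → l * secondSum A i = (m - rowSum A i) * rowSum A i :=
    fun i hi => by
      rw [← h1 _ hi, Equiv.apply_symm_apply]
      field_simp [(hr i).ne']
      ring
  have hW : ∀ i, ¬ (σ.symm i : ℕ) < k → secondSum A i = l * ((m - rowSum A i) * rowSum A i) :=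
    fun i hi => by
      rw [← h2 _ (not_lt.1 hi), Equiv.apply_symm_apply]
      field_simp [(hr i).ne', hl.ne']
      ring
  have hrm : ∀ i, rowSum A i < m := fun i => by
    refine sub_pos.1 (pos_of_mul_pos_left ?_ (hr i).le)
    by_cases hi : (σ.symm i : ℕ) < k
    · rw [← hU i hi]
      exact mul_pos hl (hs i)
    · exact pos_of_mul_pos_right (hW i hi ▸ hs i) hl.le
  -- Edges only join different blocks, so rescaling `r` by `l` on the second block multiplies `s_i`
  -- by `l` exactly for `i` in the first.
  let y : Fin n → ℝ := fun i => if (σ.symm i : ℕ) < k then rowSum A i else l * rowSum A i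
  have hrho : rho (addRowSums A) = m := by
    refine rho_eq_of_pos_eigenvector (x := y)
      (fun i j => (hA.nonneg i j).trans (le_addRowSums hA.nonneg i j)) (fun i => ?_)
      (funext fun i => ?_)
    · simp only [y]
      split_ifs
      exacts [hr i, mul_pos hl (hr i)]
    · rw [addRowSums_mulVec, Pi.smul_apply, smul_eq_mul]
      by_cases hi : (σ.symm i : ℕ) < k
      · have : ∑ j, A i j * y j = l * secondSum A i := by
          rw [secondSum, Finset.mul_sum]
          refine Finset.sum_congr rfl fun j _ => ?_
          by_cases hij : A i j = 0
          · simp [hij]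
          · have hj : ¬ (σ.symm j : ℕ) < k := by have := hne i j hij; tauto
            simp only [y, if_neg hj]
            ring
        rw [this, hU i hi]
        simp only [y, if_pos hi]
        ring
      · have : ∑ j, A i j * y j = secondSum A i := by
          rw [secondSum]
          refine Finset.sum_congr rfl fun j _ => ?_
          by_cases hij : A i j = 0
          · simp [hij]
          · have hj : (σ.symm j : ℕ) < k := by have := hne i j hij; tauto
            simp only [y, if_pos hj]
        rw [this, hW i hi]
        simp only [y, if_neg hi]
        ring
  rw [hrho]
  refine F_eq (hr i) (hr j) (hrm i) (hrm j) ?_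
  rcases hne i j hij with ⟨hi, hj⟩ | ⟨hi, hj⟩
  · rw [← hU i hi, hW j hj]
    ring
  · rw [← hU j hj, hW i hi]
    ring

lemma exists_perm_lt_iff (p : Fin n → Prop) [DecidablePred p] :
    ∃ σ : Equiv.Perm (Fin n), ∀ i : Fin n, (i : ℕ) < Fintype.card {i // p i} ↔ p (σ i) := by
  have hle : Fintype.card {i // p i} ≤ n := by simpa using Fintype.card_subtype_le p
  have e : {i : Fin n // (i : ℕ) < Fintype.card {i // p i}} ≃ {i // p i} :=
    Fintype.equivOfCardEq <| by
      rw [← Fintype.card_congr (Fin.castLEquiv hle), Fintype.card_fin]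
  refine ⟨e.extendSubtype, fun i => ⟨fun h => e.extendSubtype_mem i h, fun h => ?_⟩⟩
  by_contra hi
  exact e.extendSubtype_not_mem i hi h

theorem condI_or_condII [NeZero n] (hA : A.IsIrreducible) (hdiag : ∀ i, A i i = 0)
    {ε : ℝ} (hε : ε = 1 ∨ ε = -1)
    (H : ∀ i j, A i j ≠ 0 → ε * F A i j ≤ ε * rho (addRowSums A)) :
    CondI A ∨ ∃ l : ℝ, 0 < l ∧ ε * l < ε ∧ CondII A l := by
  classical
  have hr := rowSum_pos hA hdiag
  have hs := secondSum_pos hA hdiag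
  have hneg : ∀ i j, A i j ≠ 0 → 0 < A i j := fun i j h => (hA.nonneg i j).lt_of_ne' h
  obtain ⟨μ, y, hy, hBy⟩ := exists_pos_eigenvector_of_isIrreducible_le hA (le_addRowSums hA.nonneg)
  rw [rho_eq_of_pos_eigenvector
    (fun i j => (hA.nonneg i j).trans (le_addRowSums hA.nonneg i j)) hy hBy] at H
  have hAy : ∀ i, ∑ j, A i j * y j = (μ - rowSum A i) * y i := fun i => by
    have := congrFun hBy i
    rw [addRowSums_mulVec, Pi.smul_apply, smul_eq_mul] at this
    linarith
  have hrμ : ∀ i, rowSum A i < μ := fun i => by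
    obtain ⟨j, hj⟩ := exists_pos_of_isIrreducible hA hdiag i
    refine sub_pos.1 (pos_of_mul_pos_left ?_ (hy i).le)
    rw [← hAy]
    exact Finset.sum_pos' (fun k _ => mul_nonneg (hA.nonneg i k) (hy k).le)
      ⟨j, Finset.mem_univ j, mul_pos hj (hy j)⟩
  have hpos : ∀ i j, 0 < A i j * rowSum A j ↔ 0 < A i j := fun i j =>
    mul_pos_iff_of_pos_right (hr j)
  have heq : ∀ i, ∑ j, A i j * rowSum A j * (y j / rowSum A j) =
      (μ - rowSum A i) * rowSum A i * (y i / rowSum A i) := fun i => by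
    have h1 : ∀ j, rowSum A j * (y j / rowSum A j) = y j := fun j => mul_div_cancel₀ _ (hr j).ne'
    simp only [mul_assoc, h1, hAy]
  obtain ⟨a, b, ha, hb, hba, hab⟩ := exists_two_values (C := fun i j => A i j * rowSum A j)
    (U := fun i => (μ - rowSum A i) * rowSum A i) (x := fun i => y i / rowSum A i) hε
    (fun i j => mul_nonneg (hA.nonneg i j) (hr j).le)
    (fun i j => Relation.ReflTransGen.mono (fun i j h => (hpos i j).2 h) _ _
      (reflTransGen_of_isIrreducible hA i j))
    hs (fun i => mul_pos (sub_pos.2 (hrμ i)) (hr i)) (fun i => div_pos (hy i) (hr i)) heq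
    (fun i j hij => by
      have := H i j ((hpos i j).1 hij).ne'
      rcases hε with rfl | rfl
      · rw [one_mul, one_mul] at this ⊢
        exact (F_le_iff (hr i) (hr j) (hrμ i) (hrμ j)).1 this
      · rw [neg_one_mul, neg_one_mul, neg_le_neg_iff] at this ⊢
        exact (le_F_iff (hr i) (hr j) (hrμ i) (hrμ j)).1 this)
  simp only [hpos] at hab
  have hrow : ∀ i c d, y i / rowSum A i = c → (∀ j, 0 < A i j → y j / rowSum A j = d) →
      secondSum A i * d = (μ - rowSum A i) * rowSum A i * c := fun i c d hc hd => by
    rw [← hc, ← heq, secondSum, Finset.sum_mul]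
    refine Finset.sum_congr rfl fun j _ => ?_
    rcases (hA.nonneg i j).eq_or_lt with h | h
    · simp [← h]
    · rw [hd j h]
  by_cases hne : a = b
  · left
    have hI : ∀ i, rowSum A i + secondSum A i / rowSum A i = μ := fun i => by
      have : secondSum A i * b = (μ - rowSum A i) * rowSum A i * b := by
        rcases hab i with ⟨h1, h2⟩ | ⟨h1, h2⟩
        · exact hrow i b b (h1.trans hne) h2
        · exact hrow i b b h1 fun j hj => (h2 j hj).trans hne
      rw [mul_right_cancel₀ hb.ne' this]
      field_simp [(hr i).ne']
      ring
    exact fun i j => (hI i).trans (hI j).symm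
  · right
    have hlt : ε * b < ε * a := lt_of_le_of_ne hba fun h => by
      rcases hε with rfl | rfl <;> exact hne (by linarith)
    -- Where `x = a`, `hrow` reads `s_i b = U_i a`, that is `r_i + (b / a) s_i / r_i = μ`; where `x
    -- = b` the ratio is inverted.
    refine ⟨b / a, div_pos hb ha, ?_, ?_⟩
    · rw [← mul_div_assoc, div_lt_iff₀ ha]
      exact hlt
    obtain ⟨σ, hσ⟩ := exists_perm_lt_iff fun i => y i / rowSum A i = a
    have hboth : (∃ i, y i / rowSum A i = a) ∧ ∃ i, y i / rowSum A i = b := by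
      obtain ⟨j, hj⟩ := exists_pos_of_isIrreducible hA hdiag 0
      rcases hab 0 with ⟨h1, h2⟩ | ⟨h1, h2⟩
      · exact ⟨⟨0, h1⟩, ⟨j, h2 j hj⟩⟩
      · exact ⟨⟨j, h2 j hj⟩, ⟨0, h1⟩⟩
    obtain ⟨⟨ia, hia⟩, ⟨ib, hib⟩⟩ := hboth
    have hA' : ∀ i, y i / rowSum A i = a → ∀ j, 0 < A i j → y j / rowSum A j = b :=
      fun i hi => (hab i).elim (fun h => h.2) fun h => absurd (hi.symm.trans h.1) hne
    have hB' : ∀ i, y i / rowSum A i ≠ a → y i / rowSum A i = b ∧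
        ∀ j, 0 < A i j → y j / rowSum A j = a :=
      fun i hi => (hab i).resolve_left fun h => hi h.1
    refine ⟨Fintype.card {i // y i / rowSum A i = a}, Fintype.card_pos_iff.2 ⟨⟨ia, hia⟩⟩, ?_, σ,
      ?_, μ, fun i hi => ?_, fun i hi => ?_⟩
    · have := Fintype.card_subtype_lt (p := fun i => y i / rowSum A i = a) (x := ib)
        (by rw [hib]; exact Ne.symm hne)
      simpa using this
    · rw [isPartitioned_addRowSums_iff]
      intro i j _ h
      by_contra hij
      have hij' := hneg _ _ hij
      rcases h with ⟨hi, hj⟩ | ⟨hi, hj⟩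
      · rw [hσ] at hi hj
        exact hne (hj.symm.trans (hA' _ hi _ hij'))
      · rw [← not_lt, hσ] at hi hj
        exact hj ((hB' _ hi).2 _ hij')
    · rw [hσ] at hi
      have := hrow _ a b hi (hA' _ hi)
      have hr' := hr (σ i)
      field_simp
      linarith
    · rw [← not_lt, hσ] at hi
      have := hrow _ b a (hB' _ hi).1 (hB' _ hi).2
      have hr' := hr (σ i)
      field_simp
      linarith

end SpectralBounds

theorem corollary2p2 {n : ℕ} (hn : 1 ≤ n) (A : Matrix (Fin n) (Fin n) ℝ)
    (hirr : A.IsIrreducible) (hdiag : ∀ i : Fin n, A i i = 0) :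
    ∃ Fmin Fmax : ℝ,
      IsLeast (SpectralBounds.FValues A) Fmin ∧
      IsGreatest (SpectralBounds.FValues A) Fmax ∧
      Fmin ≤ SpectralBounds.rho (SpectralBounds.addRowSums A) ∧
      SpectralBounds.rho (SpectralBounds.addRowSums A) ≤ Fmax ∧
      (Fmin = SpectralBounds.rho (SpectralBounds.addRowSums A) ↔
        SpectralBounds.CondI A ∨ ∃ l : ℝ, 0 < l ∧ SpectralBounds.CondII A l) ∧
      (SpectralBounds.rho (SpectralBounds.addRowSums A) = Fmax ↔
        SpectralBounds.CondI A ∨ ∃ l : ℝ, 0 < l ∧ SpectralBounds.CondII A l) ∧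
      (Fmin = SpectralBounds.rho (SpectralBounds.addRowSums A) ↔
        SpectralBounds.CondI A ∨ ∃ l : ℝ, 1 < l ∧ SpectralBounds.CondII A l) ∧
      (SpectralBounds.rho (SpectralBounds.addRowSums A) = Fmax ↔
        SpectralBounds.CondI A ∨ ∃ l : ℝ, 0 < l ∧ l < 1 ∧ SpectralBounds.CondII A l) := by
  open SpectralBounds in
  have : NeZero n := ⟨by omega⟩
  have hfin : (FValues A).Finite := by
    refine (Set.finite_range fun p : Fin n × Fin n => F A p.1 p.2).subset ?_
    rintro _ ⟨i, j, -, rfl⟩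
    exact ⟨(i, j), rfl⟩
  have hnon : (FValues A).Nonempty := by
    obtain ⟨j, hj⟩ := exists_pos_of_isIrreducible hirr hdiag 0
    exact ⟨_, 0, j, hj.ne', rfl⟩
  obtain ⟨Fmin, hmin⟩ : ∃ m, IsLeast (FValues A) m := by
    obtain ⟨m, hm, h⟩ := Set.exists_min_image _ id hfin hnon
    exact ⟨m, hm, h⟩
  obtain ⟨Fmax, hmax⟩ : ∃ m, IsGreatest (FValues A) m := by
    obtain ⟨m, hm, h⟩ := Set.exists_max_image _ id hfin hnon
    exact ⟨m, hm, h⟩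
  have hback : (CondI A ∨ ∃ l : ℝ, 0 < l ∧ CondII A l) →
      ∀ v ∈ FValues A, v = rho (addRowSums A) := by
    rintro (h | ⟨l, hl, h⟩) _ ⟨i, j, hij, rfl⟩
    · exact F_eq_rho_of_condI hirr hdiag h i j
    · exact F_eq_rho_of_condII hirr hdiag hl h hij
  have hlow : rho (addRowSums A) ≤ Fmin →
      CondI A ∨ ∃ l : ℝ, 1 < l ∧ CondII A l := fun h => by
    refine (condI_or_condII hirr hdiag (Or.inr rfl) fun i j hij => ?_).imp_right ?_
    · have := hmin.2 ⟨i, j, hij, rfl⟩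
      linarith
    · rintro ⟨l, -, hl, h⟩
      exact ⟨l, by linarith, h⟩
  have hhigh : Fmax ≤ rho (addRowSums A) →
      CondI A ∨ ∃ l : ℝ, 0 < l ∧ l < 1 ∧ CondII A l := fun h => by
    refine (condI_or_condII hirr hdiag (Or.inl rfl) fun i j hij => ?_).imp_right ?_
    · have := hmax.2 ⟨i, j, hij, rfl⟩
      linarith
    · rintro ⟨l, hl0, hl, h⟩
      exact ⟨l, hl0, by linarith, h⟩
  have hlow' : (CondI A ∨ ∃ l : ℝ, 1 < l ∧ CondII A l) →
      CondI A ∨ ∃ l : ℝ, 0 < l ∧ CondII A l :=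
    Or.imp_right fun ⟨l, hl, h⟩ => ⟨l, zero_lt_one.trans hl, h⟩
  have hhigh' : (CondI A ∨ ∃ l : ℝ, 0 < l ∧ l < 1 ∧ CondII A l) →
      CondI A ∨ ∃ l : ℝ, 0 < l ∧ CondII A l :=
    Or.imp_right fun ⟨l, hl, _, h⟩ => ⟨l, hl, h⟩
  refine ⟨Fmin, Fmax, hmin, hmax, ?_, ?_, ?_, ?_, ?_, ?_⟩
  -- If `ρ(B) ≤ Fmin`, the equality case applies and yields `Fmin = ρ(B)`.
  · exact (le_total Fmin _).elim id fun h => (hback (hlow' (hlow h)) _ hmin.1).le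
  · exact (le_total _ Fmax).elim id fun h => (hback (hhigh' (hhigh h)) _ hmax.1).ge
  · exact ⟨fun h => hlow' (hlow h.ge), fun h => hback h _ hmin.1⟩
  · exact ⟨fun h => hhigh' (hhigh h.ge), fun h => (hback h _ hmax.1).symm⟩
  · exact ⟨fun h => hlow h.ge, fun h => hback (hlow' h) _ hmin.1⟩
  · exact ⟨fun h => hhigh h.ge, fun h => (hback (hhigh' h) _ hmax.1).symm⟩
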